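/- Let $\mathcal H=\{x+iy:\ x\in\mathbb R,\ y>0\}$ be the upper half-plane with Lebesgue measure $dV$, and for a bounded non-degenerate interval $I\subset\mathbb R$ of length $|I|$ let $Q_I=\{x+iy:\ x\in I,\ 0<y<|I|\}$ and $|Q_I|=\int_{Q_I}dV$. Let $1<q<p<\infty$, let $p'=p/(p-1)$, and let $\omega$ be a weight on $\mathcal H$ (a nonnegative locally integrable function) in the Békollé–Bonami class $B_p$, that is, $$\sup_{I}\left(\frac1{|Q_I|}\int_{Q_I}\omega\,dV\right)\left(\frac1{|Q_I|}\int_{Q_I}\omega^{1-p'}\,dV\right)^{p-1}<\infty .$$ Write $\omega(Q_I)=\int_{Q_I}\omega\,dV$; for $1\le r<\infty$ let $L^r_\omega(\mathcal H)$ be the space of measurable functions $f$ on $\mathcal H$ with $\|f\|_{r,\omega}=\left(\int_{\mathcal H}|f|^r\omega\,dV\right)^{1/r}<\infty$, and let $$M_\omega f(z)=\sup_{I:\ z\in Q_I}\frac1{\omega(Q_I)}\int_{Q_I}|f|\,\omega\,dV ,\qquad z\in\mathcal H.$$ All suprema are over bounded non-degenerate intervals $I\subset\mathbb R$. Let $\mu$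 be a positive Borel measure on $\mathcal H$. Then there is a constant $C>0$ such that $$\left(\int_{\mathcal H}(M_\omega f)^q\,d\mu\right)^{1/q}\le C\,\|f\|_{p,\omega}\qquad\text{for all } f\in L^p_\omega(\mathcal H)$$ if and only if the function $$K_\mu(z)=\sup_{I:\ z\in Q_I}\frac{\mu(Q_I)}{\omega(Q_I)},\qquad z\in\mathcal H,$$ belongs to $L^s_\omega(\mathcal H)$, where $s=\frac{p}{p-q}$. -/

import Mathlib

open scoped ENNReal

namespace BekolleBonami

/-- The upper half-plane, as a subset of the complex plane. -/
def halfPlane : Set ℂ := {z | 0 < z.im}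

/-- Bounded non-degenerate intervals of the real line; each endpoint may or may not belong to the
interval. -/
def IsBoundedInterval (I : Set ℝ) : Prop :=
  I.OrdConnected ∧ Bornology.IsBounded I ∧ I.Nontrivial

/-- The Carleson box over `I`: all `x + iy` with `x ∈ I` and `0 < y < |I|`. -/
def carlesonBox (I : Set ℝ) : Set ℂ :=
  {z | z.re ∈ I ∧ 0 < z.im ∧ z.im < MeasureTheory.volume.real I}

/-- Weights: nonnegative locally integrable functions on the upper half-plane. Values of `ω` outside
the upper half-plane are irrelevant. -/
def IsWeight (ω : ℂ → ℝ) : Prop :=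
  (∀ z ∈ halfPlane, 0 ≤ ω z) ∧
    MeasureTheory.LocallyIntegrableOn ω halfPlane MeasureTheory.volume

/-- The measure `ω dV` on the upper half-plane, with `dV` Lebesgue measure. The space `L^p_ω` is
the Lebesgue space of this measure. -/
noncomputable def weightMeasure (ω : ℂ → ℝ) : MeasureTheory.Measure ℂ :=
  (MeasureTheory.volume.restrict halfPlane).withDensity (fun z => ENNReal.ofReal (ω z))

/-- The Békollé–Bonami characteristic of `ω`. Negative powers of `0` are `∞`. -/
noncomputable def bpChar (p : ℝ) (ω : ℂ → ℝ) : ℝ≥0∞ :=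
  ⨆ (I : Set ℝ) (_ : IsBoundedInterval I),
    ((∫⁻ z in carlesonBox I, ENNReal.ofReal (ω z)) / MeasureTheory.volume (carlesonBox I)) *
    ((∫⁻ z in carlesonBox I, ENNReal.ofReal (ω z) ^ (1 - p.conjExponent)) /
      MeasureTheory.volume (carlesonBox I)) ^ (p - 1)

/-- The Békollé–Bonami class `B_p`. -/
def MemBp (p : ℝ) (ω : ℂ → ℝ) : Prop :=
  IsWeight ω ∧ bpChar p ω < ∞

/-- The weighted Hardy–Littlewood maximal function `M_ω f`. -/
noncomputable def maximalFunction (ω : ℂ → ℝ) (f : ℂ → ℂ) (z : ℂ) : ℝ≥0∞ :=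
  ⨆ (I : Set ℝ) (_ : IsBoundedInterval I) (_ : z ∈ carlesonBox I),
    (∫⁻ w in carlesonBox I, ‖f w‖ₑ ∂(weightMeasure ω)) / weightMeasure ω (carlesonBox I)

/-- The function `K_μ`, the supremum of `μ(Q_I) / ω(Q_I)` over the Carleson boxes containing `z`. -/
noncomputable def carlesonFunction (ω : ℂ → ℝ) (μ : MeasureTheory.Measure ℂ) (z : ℂ) : ℝ≥0∞ :=
  ⨆ (I : Set ℝ) (_ : IsBoundedInterval I) (_ : z ∈ carlesonBox I),
    μ (carlesonBox I) / weightMeasure ω (carlesonBox I)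

end BekolleBonami

/-! The engine is a covering argument. By `B_p` and Hölder, `ω dV` is doubling on Carleson boxes,
and the Vitali lemma on the line transfers to the boxes. So a superlevel set of a maximal function
contains disjoint boxes, each of large average, whose fivefold enlargements cover it.

If `K_μ ∈ L^s_ω`: `K_μ ≥ μ(Q')/ω(Q')` at every point of a selected box `Q` with enlargement `Q'`, so
`μ(Q') ≤ C ∫_Q K_μ ω`. Summing gives `μ{M_ω f > t} ≤ C ∫_{M_ω f > t} K_μ ω`. The layer cake formula
turns this into `∫ (M_ω f)^q dμ ≤ C ∫ (M_ω f)^q K_μ ω`; Hölder with exponents `s` and `p/q` and the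
boundedness of `M_ω` on `L^p_ω` finish.

Conversely, the covering also gives `t ω{K_μ > t} ≤ C μ{K_μ > t}`, hence `∫ K_μ^s ω ≤ C ∫ K_μ^{s-1}
dμ`. The test function `f = K_μ^{1/(p-q)}` satisfies `M_ω f ≥ f`, so the right side is at most a
constant times `(∫ K_μ^s ω)^{q/p}`, which is absorbed on the left since `q/p < 1`.

Absorption needs a priori finiteness. All estimates are therefore proved for maxima over finite
families of rational boxes (`finMax`), with constants independent of the family, and pass to the
full suprema by monotone convergence. -/

namespace BekolleBonami
open MeasureTheory Set Filter Topology

/-! ### Layer cake: from superlevel-set inequalities to integral inequalities. -/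

section LayerCake

variable {α : Type*} [MeasurableSpace α]

theorem lintegral_rpow_eq_lintegral_meas_lt (μ : Measure α) {g : α → ℝ≥0∞} (hg : Measurable g)
    (hg' : ∀ z, g z ≠ ∞) {r : ℝ} (hr : 0 < r) :
    ∫⁻ z, g z ^ r ∂μ = ENNReal.ofReal r *
      ∫⁻ t in Ioi (0 : ℝ), μ {z | ENNReal.ofReal t < g z} * ENNReal.ofReal (t ^ (r - 1)) := by
  have h := lintegral_rpow_eq_lintegral_meas_lt_mul μ (f := fun z => (g z).toReal)
    (.of_forall fun z => ENNReal.toReal_nonneg) hg.ennreal_toReal.aemeasurable hr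
  have h1 : ∫⁻ z, g z ^ r ∂μ = ∫⁻ z, ENNReal.ofReal ((g z).toReal ^ r) ∂μ := by
    refine lintegral_congr fun z => ?_
    rw [← ENNReal.ofReal_rpow_of_nonneg ENNReal.toReal_nonneg hr.le, ENNReal.ofReal_toReal (hg' z)]
  rw [h1, h]
  congr 1
  refine setLIntegral_congr_fun measurableSet_Ioi fun t (ht : 0 < t) => ?_
  have : {z | t < (g z).toReal} = {z | ENNReal.ofReal t < g z} := by
    ext z
    exact (ENNReal.ofReal_lt_iff_lt_toReal ht.le (hg' z)).symm
  simp only [this]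

theorem lintegral_rpow_le_of_meas_lt_le {μ ν : Measure α} {g : α → ℝ≥0∞} (hg : Measurable g)
    (hg' : ∀ z, g z ≠ ∞) {r : ℝ} (hr : 0 < r) {C : ℝ≥0∞} (hC : C ≠ ∞)
    (h : ∀ t : ℝ, 0 < t → μ {z | ENNReal.ofReal t < g z} ≤ C * ν {z | ENNReal.ofReal t < g z}) :
    ∫⁻ z, g z ^ r ∂μ ≤ C * ∫⁻ z, g z ^ r ∂ν := by
  rw [lintegral_rpow_eq_lintegral_meas_lt μ hg hg' hr,
    lintegral_rpow_eq_lintegral_meas_lt ν hg hg' hr, mul_left_comm, ← lintegral_const_mul' C _ hC]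
  refine mul_le_mul' le_rfl (setLIntegral_mono' measurableSet_Ioi fun t (ht : 0 < t) => ?_)
  rw [← mul_assoc]
  gcongr
  exact h t ht

/-- The extra factor `t` in the hypothesis is the one that separates the layer cake weights `t ^ r`
and `t ^ (r - 1)`; the constant is the ratio of the prefactors `r + 1` and `r`. -/
theorem lintegral_rpow_add_one_le_of_mul_meas_lt_le {μ ν : Measure α} {g : α → ℝ≥0∞}
    (hg : Measurable g) (hg' : ∀ z, g z ≠ ∞) {r : ℝ} (hr : 0 < r) {C : ℝ≥0∞} (hC : C ≠ ∞)
    (h : ∀ t : ℝ, 0 < t → ENNReal.ofReal t * μ {z | ENNReal.ofReal t < g z} ≤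
      C * ν {z | ENNReal.ofReal t < g z}) :
    ∫⁻ z, g z ^ (r + 1) ∂μ ≤ ENNReal.ofReal ((r + 1) / r) * C * ∫⁻ z, g z ^ r ∂ν := by
  rw [lintegral_rpow_eq_lintegral_meas_lt μ hg hg' (by linarith),
    lintegral_rpow_eq_lintegral_meas_lt ν hg hg' hr]
  have h1 : ∫⁻ t in Ioi (0 : ℝ), μ {z | ENNReal.ofReal t < g z} *
        ENNReal.ofReal (t ^ (r + 1 - 1)) ≤
      C * ∫⁻ t in Ioi (0 : ℝ), ν {z | ENNReal.ofReal t < g z} * ENNReal.ofReal (t ^ (r - 1)) := by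
    rw [← lintegral_const_mul' _ _ hC]
    refine setLIntegral_mono' measurableSet_Ioi fun t (ht : 0 < t) => ?_
    have : t ^ (r + 1 - 1) = t * t ^ (r - 1) := by
      rw [add_sub_cancel_right, Real.rpow_sub_one ht.ne']; field_simp
    rw [this, ENNReal.ofReal_mul ht.le, ← mul_assoc, ← mul_assoc, mul_comm (μ _)]
    gcongr ?_ * _
    exact h t ht
  calc _ ≤ ENNReal.ofReal (r + 1) * (C * ∫⁻ t in Ioi (0 : ℝ), ν {z | ENNReal.ofReal t < g z} *
          ENNReal.ofReal (t ^ (r - 1))) := by gcongr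
    _ = ENNReal.ofReal ((r + 1) / r * r) * (C * ∫⁻ t in Ioi (0 : ℝ),
          ν {z | ENNReal.ofReal t < g z} * ENNReal.ofReal (t ^ (r - 1))) := by
        rw [div_mul_cancel₀ _ hr.ne']
    _ = _ := by rw [ENNReal.ofReal_mul (by positivity)]; ring

end LayerCake

/-! ### Maximal functions over finite families in an abstract doubling setting. -/

section FiniteMaximal

variable {α ι : Type*} [MeasurableSpace α]

/-- The maximal function of the measure `ν` relative to `W` over a finite family of sets. -/
noncomputable def finMax (Q : ι → Set α) (W ν : Measure α) (F : Finset ι) (z : α) : ℝ≥0∞ :=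
  ⨆ i ∈ F, (Q i).indicator (fun _ => ν (Q i) / W (Q i)) z

/-- Sets `Q i` with enlargements `Q' i` for which the finite Vitali covering lemma holds and `W` is
doubling. -/
structure IsDoublingFamily (Q Q' : ι → Set α) (W : Measure α) (C : ℝ≥0∞) : Prop where
  measurableSet : ∀ i, MeasurableSet (Q i)
  pos : ∀ i, W (Q i) ≠ 0
  finite : ∀ i, W (Q i) ≠ ∞
  const_ne_top : C ≠ ∞
  doubling : ∀ i, W (Q' i) ≤ C * W (Q i)
  covering : ∀ F : Finset ι, ∃ u ⊆ F, (u : Set ι).PairwiseDisjoint Q ∧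
    ∀ i ∈ F, ∃ j ∈ u, Q i ⊆ Q' j

variable {Q Q' : ι → Set α} {W ν : Measure α} {C : ℝ≥0∞}

theorem measurable_finMax (hQ : ∀ i, MeasurableSet (Q i)) (F : Finset ι) :
    Measurable (finMax Q W ν F) :=
  Measurable.biSup _ F.countable_toSet fun i _ => measurable_const.indicator (hQ i)

theorem le_finMax {F : Finset ι} {i : ι} (hi : i ∈ F) {z : α} (hz : z ∈ Q i) :
    ν (Q i) / W (Q i) ≤ finMax Q W ν F z := by
  refine le_trans ?_ (le_iSup₂ (f := fun i _ => (Q i).indicator (fun _ => ν (Q i) / W (Q i)) z)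
    i hi)
  simp [hz]

theorem finMax_mono {F G : Finset ι} (h : F ⊆ G) : finMax Q W ν F ≤ finMax Q W ν G :=
  fun _ => biSup_mono fun _ hi => h hi

theorem finMax_le_sum (F : Finset ι) (z : α) :
    finMax Q W ν F z ≤ ∑ i ∈ F, (Q i).indicator (fun _ => ν (Q i) / W (Q i)) z :=
  iSup₂_le fun _ hi => Finset.single_le_sum
    (f := fun i => (Q i).indicator (fun _ => ν (Q i) / W (Q i)) z) (fun _ _ => zero_le) hi

namespace IsDoublingFamily

theorem finMax_ne_top (hQ : IsDoublingFamily Q Q' W C) (hν : ∀ i, ν (Q i) ≠ ∞) (F : Finset ι)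
    (z : α) : finMax Q W ν F z ≠ ∞ := by
  refine ne_top_of_le_ne_top (ENNReal.sum_ne_top.2 fun i _ => ?_) (finMax_le_sum F z)
  by_cases hz : z ∈ Q i
  · simpa [hz] using ENNReal.div_ne_top (hν i) (hQ.pos i)
  · simp [hz]

/-- A finite maximum is bounded and lives on finitely many sets of finite measure. This is the a
priori finiteness that makes absorption legitimate. -/
theorem lintegral_finMax_rpow_ne_top (hQ : IsDoublingFamily Q Q' W C) (hν : ∀ i, ν (Q i) ≠ ∞)
    (F : Finset ι) {r : ℝ} (hr : 0 < r) : ∫⁻ z, finMax Q W ν F z ^ r ∂W ≠ ∞ := by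
  have h : ∀ z, finMax Q W ν F z ^ r ≤
      ∑ i ∈ F, (Q i).indicator (fun _ => (∑ i ∈ F, ν (Q i) / W (Q i)) ^ r) z := by
    intro z
    by_cases hz : ∃ i ∈ F, z ∈ Q i
    · obtain ⟨i, hi, hzi⟩ := hz
      refine le_trans ?_ (Finset.single_le_sum (f := fun i => (Q i).indicator
        (fun _ => (∑ i ∈ F, ν (Q i) / W (Q i)) ^ r) z) (fun _ _ => zero_le) hi)
      simp only [hzi, indicator_of_mem]
      gcongr
      exact (finMax_le_sum F z).trans
        (Finset.sum_le_sum fun j _ => indicator_le_self' (fun _ _ => zero_le) z)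
    · push Not at hz
      have : finMax Q W ν F z = 0 := by
        simp only [finMax, ENNReal.iSup_eq_zero]
        intro i hi
        simp [hz i hi]
      simp [this, hr]
  refine ne_top_of_le_ne_top ?_ (lintegral_mono h)
  rw [lintegral_finsetSum _ fun i _ => measurable_const.indicator (hQ.measurableSet i)]
  refine ENNReal.sum_ne_top.2 fun i _ => ?_
  rw [lintegral_indicator_const (hQ.measurableSet i)]
  refine ENNReal.mul_ne_top (ENNReal.rpow_ne_top_of_nonneg hr.le ?_) (hQ.finite i)
  exact ENNReal.sum_ne_top.2 fun i _ => ENNReal.div_ne_top (hν i) (hQ.pos i)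

/-- The superlevel sets of `finMax` are covered by the enlargements of a disjoint family of sets
contained in them. -/
theorem exists_disjoint_covering (hQ : IsDoublingFamily Q Q' W C) (ν : Measure α) (F : Finset ι)
    (t : ℝ≥0∞) : ∃ u : Finset ι, (u : Set ι).PairwiseDisjoint Q ∧
      (∀ i ∈ u, t * W (Q i) ≤ ν (Q i)) ∧ (⋃ i ∈ u, Q i) ⊆ {z | t < finMax Q W ν F z} ∧
      {z | t < finMax Q W ν F z} ⊆ ⋃ i ∈ u, Q' i := by
  classical
  -- Vitali selection among the sets of average above `t`; their union is the superlevel set.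
  obtain ⟨u, hu, hd, hc⟩ := hQ.covering (F.filter fun i => t < ν (Q i) / W (Q i))
  have hu' : ∀ i ∈ u, i ∈ F ∧ t < ν (Q i) / W (Q i) := fun i hi => Finset.mem_filter.1 (hu hi)
  refine ⟨u, hd, fun i hi => ?_, ?_, ?_⟩
  · exact (ENNReal.le_div_iff_mul_le (.inl (hQ.pos i)) (.inl (hQ.finite i))).1 (hu' i hi).2.le
  · exact iUnion₂_subset fun i hi z hz => (hu' i hi).2.trans_le (le_finMax (hu' i hi).1 hz)
  · intro z hz
    simp only [finMax, mem_ofPred_eq, lt_iSup_iff] at hz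
    obtain ⟨i, hi, hzi⟩ := hz
    have hz' : z ∈ Q i := by
      by_contra hcon
      simp [hcon] at hzi
    simp only [hz', indicator_of_mem] at hzi
    obtain ⟨j, hj, hij⟩ := hc i (Finset.mem_filter.2 ⟨hi, hzi⟩)
    exact mem_biUnion (x := j) hj (hij hz')

/-- Weak-type bound keeping `ν` of the superlevel set on the right rather than its total mass: the
selected sets are disjoint and lie inside the superlevel set. This localization is what yields
strong-type bounds. -/
theorem mul_meas_lt_finMax_le (hQ : IsDoublingFamily Q Q' W C) (F : Finset ι) (t : ℝ≥0∞) :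
    t * W {z | t < finMax Q W ν F z} ≤ C * ν {z | t < finMax Q W ν F z} := by
  obtain ⟨u, hd, ht, hsub, hcov⟩ := hQ.exists_disjoint_covering ν F t
  calc t * W {z | t < finMax Q W ν F z} ≤ t * ∑ i ∈ u, W (Q' i) := by
        gcongr
        exact (measure_mono hcov).trans (measure_biUnion_finset_le _ _)
    _ ≤ t * ∑ i ∈ u, C * W (Q i) := by gcongr with i hi; exact hQ.doubling i
    _ = C * ∑ i ∈ u, t * W (Q i) := by rw [← Finset.mul_sum, ← Finset.mul_sum]; ring
    _ ≤ C * ∑ i ∈ u, ν (Q i) := by gcongr with i hi; exact ht i hi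
    _ = C * ν (⋃ i ∈ u, Q i) := by
        rw [measure_biUnion_finset hd fun i _ => hQ.measurableSet i]
    _ ≤ _ := by gcongr

/-- The Carleson condition controls `μ` on enlargements by the density `K` on the original disjoint
sets, so the `μ`-size of a superlevel set is dominated by its size for `K dW`. -/
theorem meas_lt_finMax_le (hQ : IsDoublingFamily Q Q' W C) {μ : Measure α} {K : α → ℝ≥0∞}
    (hK : ∀ i, ∀ z ∈ Q i, μ (Q' i) ≤ K z * W (Q' i)) (F : Finset ι) (t : ℝ≥0∞) :
    μ {z | t < finMax Q W ν F z} ≤ C * W.withDensity K {z | t < finMax Q W ν F z} := by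
  obtain ⟨u, hd, -, hsub, hcov⟩ := hQ.exists_disjoint_covering ν F t
  have key : ∀ i, μ (Q' i) ≤ C * W.withDensity K (Q i) := by
    intro i
    rw [withDensity_apply _ (hQ.measurableSet i)]
    -- Multiplying by `W (Q i)` allows the pointwise bound on `μ (Q' i)` to be integrated over `Q
    -- i`.
    refine (ENNReal.mul_le_mul_iff_left (hQ.pos i) (hQ.finite i)).1 ?_
    calc μ (Q' i) * W (Q i) = ∫⁻ _ in Q i, μ (Q' i) ∂W := by simp
      _ ≤ ∫⁻ z in Q i, (C * W (Q i)) * K z ∂W := by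
          refine setLIntegral_mono' (hQ.measurableSet i) fun z hz => (hK i z hz).trans ?_
          rw [mul_comm]
          gcongr
          exact hQ.doubling i
      _ = C * (∫⁻ z in Q i, K z ∂W) * W (Q i) := by
          rw [lintegral_const_mul' _ _ (ENNReal.mul_ne_top hQ.const_ne_top (hQ.finite i))]
          ring
  calc μ {z | t < finMax Q W ν F z} ≤ ∑ i ∈ u, μ (Q' i) :=
        (measure_mono hcov).trans (measure_biUnion_finset_le _ _)
    _ ≤ ∑ i ∈ u, C * W.withDensity K (Q i) := Finset.sum_le_sum fun i _ => key i
    _ = C * W.withDensity K (⋃ i ∈ u, Q i) := by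
        rw [measure_biUnion_finset hd fun i _ => hQ.measurableSet i, Finset.mul_sum]
    _ ≤ _ := by gcongr

/-- If `X ≤ A X ^ θ` with `θ < 1` and `X` finite, then `X` is bounded in terms of `A`. -/
theorem _root_.ENNReal.le_rpow_of_le_mul_rpow {X A : ℝ≥0∞} {θ : ℝ} (hθ : θ < 1) (hX : X ≠ ∞)
    (h : X ≤ A * X ^ θ) : X ≤ A ^ (1 / (1 - θ)) := by
  rcases eq_or_ne X 0 with rfl | h0
  · exact zero_le
  have h1 : X ^ (1 - θ) ≤ A := by
    rw [ENNReal.rpow_sub _ _ h0 hX, ENNReal.rpow_one]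
    exact ENNReal.div_le_of_le_mul h
  have hθ' : 0 < 1 - θ := by linarith
  rw [one_div]
  exact (ENNReal.le_rpow_inv_iff hθ').2 h1

/-- The strong type `(p, p)` inequality, with a constant independent of the finite family. -/
theorem lintegral_finMax_rpow_le (hQ : IsDoublingFamily Q Q' W C) {p : ℝ} (hp : 1 < p)
    {h : α → ℝ≥0∞} (hm : AEMeasurable h W) (hfin : ∀ i, W.withDensity h (Q i) ≠ ∞)
    (F : Finset ι) :
    ∫⁻ z, finMax Q W (W.withDensity h) F z ^ p ∂W ≤
      (ENNReal.ofReal (p / (p - 1)) * C) ^ p * ∫⁻ z, h z ^ p ∂W := by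
  set g := finMax Q W (W.withDensity h) F with hg
  have hgm : Measurable g := measurable_finMax hQ.measurableSet F
  set X := ∫⁻ z, g z ^ p ∂W with hX
  have hp0 : 0 < p := by linarith
  have h1 : X ≤ ENNReal.ofReal (p / (p - 1)) * C *
      ∫⁻ z, g z ^ (p - 1) ∂(W.withDensity h) := by
    have := lintegral_rpow_add_one_le_of_mul_meas_lt_le hgm (hQ.finMax_ne_top hfin F)
      (r := p - 1) (by linarith) hQ.const_ne_top
      fun t _ => hQ.mul_meas_lt_finMax_le (ν := W.withDensity h) F (ENNReal.ofReal t)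
    simpa using this
  have hconj : p.HolderConjugate (p / (p - 1)) := by
    rw [Real.holderConjugate_iff]
    refine ⟨hp, ?_⟩
    field_simp
    ring
  have h2 : ∫⁻ z, g z ^ (p - 1) ∂(W.withDensity h) ≤
      (∫⁻ z, h z ^ p ∂W) ^ (1 / p) * X ^ ((p - 1) / p) := by
    rw [lintegral_withDensity_eq_lintegral_mul₀ hm (hgm.pow_const _).aemeasurable]
    refine (ENNReal.lintegral_mul_le_Lp_mul_Lq W hconj hm (hgm.pow_const _).aemeasurable).trans ?_
    have : ∀ z, (g z ^ (p - 1)) ^ (p / (p - 1)) = g z ^ p := fun z => by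
      rw [← ENNReal.rpow_mul, mul_div_cancel₀ _ (by linarith)]
    simp only [this, one_div_div]
    rfl
  -- Hölder has left the power `(p - 1) / p < 1` of `X` on the right; it is absorbed because `X` is
  -- finite.
  have h3 := ENNReal.le_rpow_of_le_mul_rpow (A := ENNReal.ofReal (p / (p - 1)) * C *
    (∫⁻ z, h z ^ p ∂W) ^ (1 / p)) (θ := (p - 1) / p) (by rw [div_lt_one hp0]; linarith)
    (hQ.lintegral_finMax_rpow_ne_top hfin F hp0)
    (h1.trans (by rw [mul_assoc _ _ (X ^ _)]; gcongr))
  refine h3.trans (le_of_eq ?_)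
  have : 1 / (1 - (p - 1) / p) = p := by field_simp; ring
  rw [this, ENNReal.mul_rpow_of_nonneg _ _ hp0.le, ← ENNReal.rpow_mul, one_div_mul_cancel hp0.ne',
    ENNReal.rpow_one]

/-- The Carleson embedding for `finMax`, with a constant independent of the finite family. -/
theorem lintegral_finMax_rpow_le_of_carleson (hQ : IsDoublingFamily Q Q' W C) {p q : ℝ}
    (hq : 1 < q) (hqp : q < p) {μ : Measure α} {K : α → ℝ≥0∞} (hKm : AEMeasurable K W)
    (hK : ∀ i, ∀ z ∈ Q i, μ (Q' i) ≤ K z * W (Q' i))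
    {h : α → ℝ≥0∞} (hm : AEMeasurable h W) (hfin : ∀ i, W.withDensity h (Q i) ≠ ∞)
    (F : Finset ι) :
    ∫⁻ z, finMax Q W (W.withDensity h) F z ^ q ∂μ ≤
      C * (∫⁻ z, K z ^ (p / (p - q)) ∂W) ^ (1 / (p / (p - q))) *
        ((ENNReal.ofReal (p / (p - 1)) * C) ^ p * ∫⁻ z, h z ^ p ∂W) ^ (q / p) := by
  have hp : 1 < p := hq.trans hqp
  have hpq : 0 < p - q := by linarith
  refine (lintegral_rpow_le_of_meas_lt_le (measurable_finMax hQ.measurableSet F)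
    (hQ.finMax_ne_top hfin F) (by linarith) hQ.const_ne_top
    fun t _ => hQ.meas_lt_finMax_le hK F (ENNReal.ofReal t)).trans ?_
  have hgm : Measurable (finMax Q W (W.withDensity h) F) := measurable_finMax hQ.measurableSet F
  rw [mul_assoc]
  gcongr
  have hconj : (p / (p - q)).HolderConjugate (p / q) := by
    rw [Real.holderConjugate_iff]
    refine ⟨by rw [one_lt_div hpq]; linarith, ?_⟩
    field_simp
    ring
  rw [lintegral_withDensity_eq_lintegral_mul₀ hKm (hgm.pow_const _).aemeasurable]
  refine (ENNReal.lintegral_mul_le_Lp_mul_Lq W hconj hKm (hgm.pow_const _).aemeasurable).trans ?_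
  have : ∀ z, (finMax Q W (W.withDensity h) F z ^ q) ^ (p / q) =
      finMax Q W (W.withDensity h) F z ^ p := fun z => by
    rw [← ENNReal.rpow_mul, mul_div_cancel₀ _ (by linarith)]
  simp only [this, one_div_div]
  gcongr
  exact hQ.lintegral_finMax_rpow_le hp hm hfin F

/-- The reverse inequality: testing on powers of `finMax` of `μ` bounds its norm. -/
theorem lintegral_finMax_rpow_le_of_testing (hQ : IsDoublingFamily Q Q' W C) {p q : ℝ}
    (hq : 1 < q) (hqp : q < p) {μ : Measure α} (hfin : ∀ i, μ (Q i) ≠ ∞) {A : ℝ≥0∞}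
    (F : Finset ι)
    (h : ∫⁻ z, finMax Q W μ F z ^ (q / (p - q)) ∂μ ≤
      A * (∫⁻ z, finMax Q W μ F z ^ (p / (p - q)) ∂W) ^ (q / p)) :
    ∫⁻ z, finMax Q W μ F z ^ (p / (p - q)) ∂W ≤
      (ENNReal.ofReal (p / q) * C * A) ^ (p / (p - q)) := by
  have hpq : 0 < p - q := by linarith
  have hp0 : 0 < p := by linarith
  have hq0 : 0 < q := by linarith
  -- The layer cake bound is used with `r = q / (p - q)`, so `r + 1` is the target exponent and the
  -- constant `(r + 1) / r` equals `p / q`.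
  have hs : p / (p - q) = q / (p - q) + 1 := by field_simp; ring
  have h1 := lintegral_rpow_add_one_le_of_mul_meas_lt_le
    (measurable_finMax (W := W) (ν := μ) hQ.measurableSet F)
    (hQ.finMax_ne_top hfin F) (r := q / (p - q)) (by positivity) hQ.const_ne_top
    fun t _ => hQ.mul_meas_lt_finMax_le (ν := μ) F (ENNReal.ofReal t)
  rw [← hs, show p / (p - q) / (q / (p - q)) = p / q by field_simp] at h1
  have h2 := ENNReal.le_rpow_of_le_mul_rpow (θ := q / p) (A := ENNReal.ofReal (p / q) * C * A)
    (by rwa [div_lt_one hp0]) (hQ.lintegral_finMax_rpow_ne_top hfin F (by positivity))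
    (h1.trans (by rw [mul_assoc _ A]; gcongr))
  rwa [show 1 / (1 - q / p) = p / (p - q) by field_simp] at h2

end IsDoublingFamily

end FiniteMaximal

/-! ### Intervals, Carleson boxes and approximation by rational boxes. -/

section Geometry

variable {I J : Set ℝ}

theorem IsBoundedInterval.exists_Ioo_subset (hI : IsBoundedInterval I) :
    ∃ a b : ℝ, a < b ∧ Ioo a b ⊆ I ∧ I ⊆ Icc a b := by
  obtain ⟨ho, hb, hn⟩ := hI
  have hsub := subset_Icc_csInf_csSup hb.bddBelow hb.bddAbove
  refine ⟨sInf I, sSup I, ?_, ?_, hsub⟩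
  · obtain ⟨x, hx, y, hy, hxy⟩ := hn.exists_lt
    exact (hsub hx).1.trans_lt (hxy.trans_le (hsub hy).2)
  · exact IsConnected.Ioo_csInf_csSup_subset ⟨hn.nonempty, ho.isPreconnected⟩
      hb.bddBelow hb.bddAbove

theorem volume_real_of_Ioo_subset {a b : ℝ} (hab : a < b) (h1 : Ioo a b ⊆ I) (h2 : I ⊆ Icc a b) :
    volume.real I = b - a := by
  have hv : volume I = ENNReal.ofReal (b - a) :=
    le_antisymm ((measure_mono h2).trans_eq Real.volume_Icc)
      (Real.volume_Ioo.symm.trans_le (measure_mono h1))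
  rw [measureReal_def, hv, ENNReal.toReal_ofReal (by linarith)]

theorem IsBoundedInterval.volume_ne_top (hI : IsBoundedInterval I) : volume I ≠ ∞ :=
  hI.2.1.measure_lt_top.ne

theorem IsBoundedInterval.volume_real_pos (hI : IsBoundedInterval I) : 0 < volume.real I := by
  obtain ⟨a, b, hab, h1, h2⟩ := hI.exists_Ioo_subset
  rw [volume_real_of_Ioo_subset hab h1 h2]
  linarith

theorem isBoundedInterval_closedBall (x : ℝ) {r : ℝ} (hr : 0 < r) :
    IsBoundedInterval (Metric.closedBall x r) := by
  rw [Real.closedBall_eq_Icc]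
  exact ⟨ordConnected_Icc, Metric.isBounded_Icc _ _, x, ⟨by linarith, by linarith⟩, x + r,
    ⟨by linarith, le_rfl⟩, by linarith⟩

theorem volume_real_closedBall (x : ℝ) {r : ℝ} (hr : 0 ≤ r) :
    volume.real (Metric.closedBall x r) = 2 * r := by
  rw [measureReal_def, Real.volume_closedBall, ENNReal.toReal_ofReal (by linarith)]

theorem IsBoundedInterval.measurableSet_carlesonBox (hI : IsBoundedInterval I) :
    MeasurableSet (carlesonBox I) :=
  (Complex.measurable_re hI.1.measurableSet).inter
    ((measurableSet_lt measurable_const Complex.measurable_im).inter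
      (measurableSet_lt Complex.measurable_im measurable_const))

theorem carlesonBox_subset_halfPlane (I : Set ℝ) : carlesonBox I ⊆ halfPlane := fun _ hz => hz.2.1

theorem measurableSet_halfPlane : MeasurableSet halfPlane :=
  measurableSet_lt measurable_const Complex.measurable_im

theorem carlesonBox_mono (hIJ : I ⊆ J) (hJ : volume J ≠ ∞) : carlesonBox I ⊆ carlesonBox J :=
  fun _ hz => ⟨hIJ hz.1, hz.2.1, hz.2.2.trans_le (measureReal_mono hIJ hJ)⟩

theorem disjoint_carlesonBox (h : Disjoint I J) : Disjoint (carlesonBox I) (carlesonBox J) :=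
  disjoint_left.2 fun _ hz hz' => disjoint_left.1 h hz.1 hz'.1

theorem IsBoundedInterval.volume_carlesonBox (hI : IsBoundedInterval I) :
    volume (carlesonBox I) = ENNReal.ofReal (volume.real I ^ 2) := by
  have h : carlesonBox I = Complex.measurableEquivRealProd ⁻¹' (I ×ˢ Ioo 0 (volume.real I)) := rfl
  rw [h, Complex.volume_preserving_equiv_real_prod.measure_preimage
    (hI.1.measurableSet.prod measurableSet_Ioo).nullMeasurableSet, Measure.volume_eq_prod,
    Measure.prod_prod, Real.volume_Ioo, sub_zero, pow_two, ENNReal.ofReal_mul measureReal_nonneg,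
    ofReal_measureReal hI.volume_ne_top]

theorem IsBoundedInterval.volume_carlesonBox_ne_zero (hI : IsBoundedInterval I) :
    volume (carlesonBox I) ≠ 0 := by
  rw [hI.volume_carlesonBox]
  exact (ENNReal.ofReal_pos.2 (pow_pos hI.volume_real_pos 2)).ne'

theorem IsBoundedInterval.volume_carlesonBox_ne_top (hI : IsBoundedInterval I) :
    volume (carlesonBox I) ≠ ∞ := by
  rw [hI.volume_carlesonBox]
  exact ENNReal.ofReal_ne_top

/-- Every Carleson box is contained in boxes over rational closed balls of almost the same
measure. -/
theorem IsBoundedInterval.exists_rat_closedBall (hI : IsBoundedInterval I) {W : Measure ℂ}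
    (hW : W ≪ volume)
    (hfin : ∀ J, IsBoundedInterval J → W (carlesonBox J) ≠ ∞) {c : ℝ≥0∞}
    (hc : W (carlesonBox I) < c) :
    ∃ (x r : ℚ), 0 < r ∧ carlesonBox I ⊆ carlesonBox (Metric.closedBall (x : ℝ) r) ∧
      W (carlesonBox (Metric.closedBall (x : ℝ) r)) < c := by
  obtain ⟨a, b, hab, h1, h2⟩ := hI.exists_Ioo_subset
  have hv := volume_real_of_Ioo_subset hab h1 h2
  set m := (a + b) / 2 with hm
  set l := (b - a) / 2 with hl
  have hl0 : 0 < l := by rw [hl]; linarith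
  -- The gap `ε n` is split in thirds: one for moving the centre to a rational, one for rounding the
  -- radius, one to spare.
  let ε : ℕ → ℝ := fun n => 3 * (1 / ((n : ℝ) + 1))
  have hεpos : ∀ n, 0 < ε n := fun n => by positivity
  have hεlim : Tendsto ε atTop (𝓝 0) := by
    simpa [ε] using (tendsto_one_div_add_atTop_nhds_zero_nat (𝕜 := ℝ)).const_mul 3
  have hεanti : Antitone ε := fun i j hij =>
    mul_le_mul_of_nonneg_left (Nat.one_div_le_one_div hij) (by norm_num)
  let S : ℕ → Set ℂ := fun n => carlesonBox (Metric.closedBall m (l + ε n))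
  have hball : ∀ n, IsBoundedInterval (Metric.closedBall m (l + ε n)) := fun n =>
    isBoundedInterval_closedBall _ (by have := hεpos n; linarith)
  have hSanti : Antitone S := fun i j hij =>
    carlesonBox_mono (Metric.closedBall_subset_closedBall (by have := hεanti hij; linarith))
      (hball i).volume_ne_top
  have hlim := tendsto_measure_iInter_atTop (μ := W) (s := S)
    (fun n => (hball n).measurableSet_carlesonBox.nullMeasurableSet) hSanti
    ⟨0, hfin _ (hball 0)⟩
  -- The outer boxes shrink to a set exceeding the box only on the lines `re = a`, `re = b` and `im
  -- = b - a`, which are null.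
  have hnull : volume ((⋂ n, S n) \ carlesonBox I) = 0 := by
    have hsub : (⋂ n, S n) \ carlesonBox I ⊆ Complex.measurableEquivRealProd ⁻¹'
        (({a, b} ×ˢ univ) ∪ (univ ×ˢ {b - a})) := by
      rintro z ⟨hz, hzI⟩
      simp only [mem_iInter] at hz
      have hz1 : |z.re - m| ≤ l := by
        refine ge_of_tendsto' (f := fun n => l + ε n) (x := atTop)
          (by simpa using hεlim.const_add l) fun n => ?_
        have := (hz n).1
        rwa [Metric.mem_closedBall, Real.dist_eq] at this
      have hz2 : z.im ≤ b - a := by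
        refine ge_of_tendsto' (f := fun n => 2 * (l + ε n)) (x := atTop)
          (by simpa [hl, mul_div_cancel₀] using (hεlim.const_add l).const_mul 2) fun n => ?_
        have := (hz n).2.2
        rw [volume_real_closedBall _ (by have := hεpos n; linarith)] at this
        exact this.le
      have hz3 : 0 < z.im := (hz 0).2.1
      rw [abs_le] at hz1
      by_contra hcon
      simp only [mem_preimage, mem_union, mem_prod, mem_univ, and_true, true_and,
        mem_singleton_iff, mem_insert_iff, not_or] at hcon
      obtain ⟨⟨hca, hcb⟩, hcc⟩ := hcon
      replace hca : z.re ≠ a := hca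
      replace hcb : z.re ≠ b := hcb
      replace hcc : z.im ≠ b - a := hcc
      refine hzI ⟨h1 ⟨lt_of_le_of_ne (by linarith) hca.symm, lt_of_le_of_ne (by linarith) hcb⟩,
        hz3, ?_⟩
      rw [hv]
      exact lt_of_le_of_ne hz2 hcc
    refine measure_mono_null hsub ?_
    rw [Complex.volume_preserving_equiv_real_prod.measure_preimage
      ((((measurableSet_singleton b).insert a).prod .univ).union
        (MeasurableSet.univ.prod (measurableSet_singleton _))).nullMeasurableSet,
      measure_union_null_iff, Measure.volume_eq_prod, Measure.prod_prod, Measure.prod_prod]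
    simp [(Set.toFinite {a, b}).measure_zero]
  have hle : W (⋂ n, S n) < c := by
    refine lt_of_le_of_lt ?_ hc
    calc W (⋂ n, S n) ≤ W (((⋂ n, S n) \ carlesonBox I) ∪ carlesonBox I) :=
          measure_mono (by rw [sdiff_union_self]; exact subset_union_left)
      _ ≤ W ((⋂ n, S n) \ carlesonBox I) + W (carlesonBox I) := measure_union_le _ _
      _ = _ := by rw [hW hnull, zero_add]
  obtain ⟨n, hn⟩ := (hlim.eventually (gt_mem_nhds hle)).exists
  have hδ : 0 < ε n / 3 := by have := hεpos n; positivity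
  obtain ⟨x, hx1, hx2⟩ := exists_rat_btwn (show m < m + ε n / 3 by linarith)
  obtain ⟨r, hr1, hr2⟩ := exists_rat_btwn
    (show l + ε n / 3 < l + 2 * (ε n / 3) by linarith)
  have hr0 : (0 : ℝ) < r := by linarith
  refine ⟨x, r, by exact_mod_cast hr0, carlesonBox_mono (fun y hy => ?_)
    (isBoundedInterval_closedBall _ hr0).volume_ne_top, lt_of_le_of_lt (measure_mono ?_) hn⟩
  · have := h2 hy
    rw [Metric.mem_closedBall, Real.dist_eq, abs_le]
    constructor <;> linarith [this.1, this.2]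
  · refine carlesonBox_mono (fun y hy => ?_) (hball n).volume_ne_top
    rw [Metric.mem_closedBall, Real.dist_eq, abs_le] at hy ⊢
    constructor <;> linarith [hy.1, hy.2]

end Geometry

/-! ### Consequences of `B_p`: finiteness, positivity and doubling. -/

section Weights

variable {p : ℝ} {ω : ℂ → ℝ} {I J : Set ℝ}

theorem weightMeasure_carlesonBox (hI : IsBoundedInterval I) :
    weightMeasure ω (carlesonBox I) = ∫⁻ z in carlesonBox I, ENNReal.ofReal (ω z) := by
  rw [weightMeasure, withDensity_apply _ hI.measurableSet_carlesonBox,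
    Measure.restrict_restrict hI.measurableSet_carlesonBox,
    inter_eq_left.2 (carlesonBox_subset_halfPlane I)]

theorem weightMeasure_absolutelyContinuous (ω : ℂ → ℝ) : weightMeasure ω ≪ volume :=
  (withDensity_absolutelyContinuous _ _).trans Measure.restrict_le_self.absolutelyContinuous

theorem IsWeight.aemeasurable (hω : IsWeight ω) (I : Set ℝ) :
    AEMeasurable (fun z => ENNReal.ofReal (ω z)) (volume.restrict (carlesonBox I)) :=
  (hω.2.aestronglyMeasurable.aemeasurable.mono_set
    (carlesonBox_subset_halfPlane I)).ennreal_ofReal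

theorem mul_le_bpChar (hI : IsBoundedInterval I) :
    weightMeasure ω (carlesonBox I) / volume (carlesonBox I) *
      ((∫⁻ z in carlesonBox I, ENNReal.ofReal (ω z) ^ (1 - p.conjExponent)) /
        volume (carlesonBox I)) ^ (p - 1) ≤ bpChar p ω := by
  rw [weightMeasure_carlesonBox hI]
  exact le_iSup₂ (f := fun (I : Set ℝ) (_ : IsBoundedInterval I) =>
    ((∫⁻ z in carlesonBox I, ENNReal.ofReal (ω z)) / volume (carlesonBox I)) *
    ((∫⁻ z in carlesonBox I, ENNReal.ofReal (ω z) ^ (1 - p.conjExponent)) /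
      volume (carlesonBox I)) ^ (p - 1)) I hI

theorem one_sub_conjExponent (hp : 1 < p) : 1 - p.conjExponent = -(1 / (p - 1)) := by
  have : p - 1 ≠ 0 := by linarith
  rw [Real.conjExponent]
  field_simp
  ring

theorem MemBp.aemeasurable_rpow (hω : MemBp p ω) (I : Set ℝ) :
    AEMeasurable (fun z => ENNReal.ofReal (ω z) ^ (1 - p.conjExponent))
      (volume.restrict (carlesonBox I)) :=
  (hω.1.aemeasurable I).pow_const _

/-- Boxes reach the real axis, so local integrability in the open half-plane does not suffice. An
infinite mass would force the dual integral to vanish, but a negative power of the finite number `ω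
z` is never zero. -/
theorem MemBp.weightMeasure_carlesonBox_ne_top (hp : 1 < p) (hω : MemBp p ω)
    (hI : IsBoundedInterval I) : weightMeasure ω (carlesonBox I) ≠ ∞ := by
  intro htop
  have h := (mul_le_bpChar (p := p) (ω := ω) hI).trans_lt hω.2
  rw [htop, ENNReal.top_div_of_ne_top hI.volume_carlesonBox_ne_top, ENNReal.top_mul] at h
  · exact absurd h (lt_irrefl _)
  have h1 : ∫⁻ z in carlesonBox I, ENNReal.ofReal (ω z) ^ (1 - p.conjExponent) ≠ 0 := by
    rw [Ne, lintegral_eq_zero_iff' (hω.aemeasurable_rpow I)]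
    intro h0
    have hF : ∀ᵐ z ∂(volume.restrict (carlesonBox I)), False := by
      filter_upwards [h0] with z hz
      have hneg : 1 - p.conjExponent < 0 := by
        rw [one_sub_conjExponent hp]
        have : 0 < p - 1 := by linarith
        simpa using this
      simp [ENNReal.rpow_eq_zero_iff, hneg, not_lt.2 hneg.le] at hz
    rw [eventually_false_iff_eq_bot, ae_eq_bot, Measure.restrict_eq_zero] at hF
    exact hI.volume_carlesonBox_ne_zero hF
  have : ((∫⁻ z in carlesonBox I, ENNReal.ofReal (ω z) ^ (1 - p.conjExponent)) /
      volume (carlesonBox I)) ≠ 0 := by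
    simp [ENNReal.div_eq_zero_iff, h1, hI.volume_carlesonBox_ne_top]
  rw [Ne, ENNReal.rpow_eq_zero_iff]
  rintro (⟨h, -⟩ | ⟨-, h⟩)
  · exact this h
  · linarith

theorem MemBp.lintegral_rpow_ne_top (hp : 1 < p) (hω : MemBp p ω) (hI : IsBoundedInterval I)
    (h0 : weightMeasure ω (carlesonBox I) ≠ 0) :
    ∫⁻ z in carlesonBox I, ENNReal.ofReal (ω z) ^ (1 - p.conjExponent) ≠ ∞ := by
  intro htop
  have h := (mul_le_bpChar (p := p) (ω := ω) hI).trans_lt hω.2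
  rw [htop, ENNReal.top_div_of_ne_top hI.volume_carlesonBox_ne_top,
    ENNReal.top_rpow_of_pos (by linarith), ENNReal.mul_top] at h
  · exact absurd h (lt_irrefl _)
  · simp [ENNReal.div_eq_zero_iff, h0, hI.volume_carlesonBox_ne_top]

theorem MemBp.ae_ne_zero (hp : 1 < p) (hω : MemBp p ω) (hI : IsBoundedInterval I)
    (h0 : weightMeasure ω (carlesonBox I) ≠ 0) :
    ∀ᵐ z ∂(volume.restrict (carlesonBox I)), ENNReal.ofReal (ω z) ≠ 0 := by
  filter_upwards [ae_lt_top' (hω.aemeasurable_rpow I) (hω.lintegral_rpow_ne_top hp hI h0)]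
    with z hz hz0
  have hneg : 1 - p.conjExponent < 0 := by
    rw [one_sub_conjExponent hp]
    have : 0 < p - 1 := by linarith
    simpa using this
  rw [hz0, ENNReal.zero_rpow_of_neg hneg] at hz
  exact lt_irrefl _ hz

theorem halfPlane_eq_iUnion :
    halfPlane = ⋃ n : ℕ, carlesonBox (Metric.closedBall 0 (n + 1 : ℝ)) := by
  refine subset_antisymm (fun z hz => ?_) (iUnion_subset fun n => carlesonBox_subset_halfPlane _)
  obtain ⟨n, hn⟩ := exists_nat_gt (max |z.re| z.im)
  have h1 := (le_max_left _ _).trans_lt hn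
  have h2 := (le_max_right _ _).trans_lt hn
  refine mem_iUnion.2 ⟨n, ?_, hz, ?_⟩
  · rw [Metric.mem_closedBall, Real.dist_eq, sub_zero]
    linarith
  · rw [volume_real_closedBall _ (by positivity)]
    linarith [n.cast_nonneg (α := ℝ)]

/-- A nonzero weight charges some box. In a larger box containing that one and the given one, the
dual integral is finite, so `ω > 0` almost everywhere there. -/
theorem MemBp.weightMeasure_carlesonBox_ne_zero (hp : 1 < p) (hω : MemBp p ω)
    (hne : weightMeasure ω ≠ 0) (hI : IsBoundedInterval I) :
    weightMeasure ω (carlesonBox I) ≠ 0 := by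
  have h1 : ∃ n : ℕ, weightMeasure ω (carlesonBox (Metric.closedBall 0 (n + 1 : ℝ))) ≠ 0 := by
    by_contra! hcon
    refine hne (Measure.measure_univ_eq_zero.1 ?_)
    have h2 : weightMeasure ω halfPlane = 0 := by
      rw [halfPlane_eq_iUnion]
      exact measure_iUnion_null hcon
    have h3 : weightMeasure ω halfPlaneᶜ = 0 :=
      withDensity_absolutelyContinuous _ _ (by simp [Measure.restrict_apply' measurableSet_halfPlane])
    rw [← union_compl_self halfPlane]
    exact measure_union_null h2 h3
  obtain ⟨n, hn⟩ := h1
  obtain ⟨R, hR⟩ := hI.2.1.subset_closedBall (0 : ℝ)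
  have hmax : 0 < max R (n + 1) := lt_max_of_lt_right (by positivity)
  have hJ := isBoundedInterval_closedBall 0 hmax
  have hJ0 : weightMeasure ω (carlesonBox (Metric.closedBall 0 (max R (n + 1)))) ≠ 0 := by
    intro h
    exact hn (measure_mono_null (carlesonBox_mono
      (Metric.closedBall_subset_closedBall (le_max_right _ _)) hJ.volume_ne_top) h)
  have hsub : carlesonBox I ⊆ carlesonBox (Metric.closedBall 0 (max R (n + 1))) :=
    carlesonBox_mono (hR.trans (Metric.closedBall_subset_closedBall (le_max_left _ _)))
      hJ.volume_ne_top
  have hae := ae_restrict_of_ae_restrict_of_subset hsub (hω.ae_ne_zero hp hJ hJ0)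
  rw [weightMeasure_carlesonBox hI, Ne, lintegral_eq_zero_iff' (hω.1.aemeasurable I)]
  intro h
  have hF : ∀ᵐ z ∂(volume.restrict (carlesonBox I)), False := by
    filter_upwards [h, hae] with z h1 h2 using h2 h1
  rw [eventually_false_iff_eq_bot, ae_eq_bot, Measure.restrict_eq_zero] at hF
  exact hI.volume_carlesonBox_ne_zero hF

/-- Hölder applied to `1 = ω ^ (1 / p) * ω ^ (-(1 / p))`, valid almost everywhere because `ω` does
not vanish. -/
theorem MemBp.volume_rpow_le (hp : 1 < p) (hω : MemBp p ω) (hI : IsBoundedInterval I)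
    (h0 : weightMeasure ω (carlesonBox I) ≠ 0) :
    volume (carlesonBox I) ^ p ≤ weightMeasure ω (carlesonBox I) *
      (∫⁻ z in carlesonBox I, ENNReal.ofReal (ω z) ^ (1 - p.conjExponent)) ^ (p - 1) := by
  have hp0 : 0 < p := by linarith
  have hp1 : p - 1 ≠ 0 := by linarith
  have hconj : p.HolderConjugate p.conjExponent := Real.HolderConjugate.conjExponent hp
  have hm := hω.1.aemeasurable I
  have h := ENNReal.lintegral_mul_le_Lp_mul_Lq (volume.restrict (carlesonBox I)) hconj
    (hm.pow_const (1 / p)) (hm.pow_const (-(1 / p)))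
  have h1 : ∫⁻ z in carlesonBox I, ((fun z => ENNReal.ofReal (ω z) ^ (1 / p)) *
      fun z => ENNReal.ofReal (ω z) ^ (-(1 / p))) z = volume (carlesonBox I) := by
    rw [← setLIntegral_one]
    refine lintegral_congr_ae ?_
    filter_upwards [hω.ae_ne_zero hp hI h0] with z hz
    rw [Pi.mul_apply, ← ENNReal.rpow_add _ _ hz ENNReal.ofReal_ne_top, add_neg_cancel,
      ENNReal.rpow_zero]
  have h2 : ∀ z, (ENNReal.ofReal (ω z) ^ (1 / p)) ^ p = ENNReal.ofReal (ω z) := fun z => by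
    rw [← ENNReal.rpow_mul, one_div_mul_cancel hp0.ne', ENNReal.rpow_one]
  have h3 : ∀ z, (ENNReal.ofReal (ω z) ^ (-(1 / p))) ^ p.conjExponent =
      ENNReal.ofReal (ω z) ^ (1 - p.conjExponent) := fun z => by
    rw [← ENNReal.rpow_mul, one_sub_conjExponent hp, Real.conjExponent]
    congr 1
    field_simp
  rw [h1] at h
  simp only [h2, h3] at h
  rw [← weightMeasure_carlesonBox hI] at h
  refine (ENNReal.rpow_le_rpow h hp0.le).trans (le_of_eq ?_)
  rw [ENNReal.mul_rpow_of_nonneg _ _ hp0.le, ← ENNReal.rpow_mul, ← ENNReal.rpow_mul,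
    one_div_mul_cancel hp0.ne', ENNReal.rpow_one, Real.conjExponent]
  congr 2
  field_simp

/-- Hölder on the small box meets the `B_p` bound on the large one, linked by monotonicity of the
dual integral. -/
theorem MemBp.weightMeasure_mul_volume_rpow_le (hp : 1 < p) (hω : MemBp p ω)
    (hne : weightMeasure ω ≠ 0) (hI : IsBoundedInterval I) (hJ : IsBoundedInterval J)
    (hIJ : I ⊆ J) :
    weightMeasure ω (carlesonBox J) * volume (carlesonBox I) ^ p ≤
      bpChar p ω * volume (carlesonBox J) ^ p * weightMeasure ω (carlesonBox I) := by
  have hp1 : 0 ≤ p - 1 := by linarith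
  have hI0 := hω.weightMeasure_carlesonBox_ne_zero hp hne hI
  have hV0 := hJ.volume_carlesonBox_ne_zero
  have hVt := hJ.volume_carlesonBox_ne_top
  set V := volume (carlesonBox J) with hV
  set D := ∫⁻ z in carlesonBox J, ENNReal.ofReal (ω z) ^ (1 - p.conjExponent) with hD
  have hB : weightMeasure ω (carlesonBox J) * D ^ (p - 1) ≤ bpChar p ω * V ^ p := by
    have h := mul_le_bpChar (p := p) (ω := ω) hJ
    rw [ENNReal.div_rpow_of_nonneg _ _ hp1] at h
    have hVp : V ^ p = V * V ^ (p - 1) := by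
      conv_rhs => rw [← ENNReal.rpow_one V, ← ENNReal.rpow_mul, one_mul,
        ← ENNReal.rpow_add _ _ hV0 hVt, add_sub_cancel]
    have hVp0 : V ^ (p - 1) ≠ 0 := (ENNReal.rpow_pos hV0.bot_lt hVt).ne'
    have hVpt : V ^ (p - 1) ≠ ∞ := ENNReal.rpow_ne_top_of_nonneg hp1 hVt
    calc weightMeasure ω (carlesonBox J) * D ^ (p - 1)
        = (weightMeasure ω (carlesonBox J) / V * V) * (D ^ (p - 1) / V ^ (p - 1) * V ^ (p - 1)) := by
          rw [ENNReal.div_mul_cancel hV0 hVt, ENNReal.div_mul_cancel hVp0 hVpt]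
      _ = (weightMeasure ω (carlesonBox J) / V * (D ^ (p - 1) / V ^ (p - 1))) * V ^ p := by
          rw [hVp]; ring
      _ ≤ _ := by gcongr
  calc weightMeasure ω (carlesonBox J) * volume (carlesonBox I) ^ p
      ≤ weightMeasure ω (carlesonBox J) * (weightMeasure ω (carlesonBox I) * D ^ (p - 1)) := by
        gcongr
        refine (hω.volume_rpow_le hp hI hI0).trans ?_
        gcongr
        exact lintegral_mono_set (carlesonBox_mono hIJ hJ.volume_ne_top)
    _ = (weightMeasure ω (carlesonBox J) * D ^ (p - 1)) * weightMeasure ω (carlesonBox I) := by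
        ring
    _ ≤ _ := by gcongr

theorem MemBp.weightMeasure_closedBall_le (hp : 1 < p) (hω : MemBp p ω)
    (hne : weightMeasure ω ≠ 0) (x : ℝ) {r : ℝ} (hr : 0 < r) :
    weightMeasure ω (carlesonBox (Metric.closedBall x (5 * r))) ≤
      bpChar p ω * 25 ^ p * weightMeasure ω (carlesonBox (Metric.closedBall x r)) := by
  have hp0 : 0 ≤ p := by linarith
  have hI := isBoundedInterval_closedBall x hr
  have hJ := isBoundedInterval_closedBall x (show 0 < 5 * r by linarith)
  have h := hω.weightMeasure_mul_volume_rpow_le hp hne hI hJ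
    (Metric.closedBall_subset_closedBall (by linarith))
  -- The area of a box is the square of its side, so the dilation by 5 gives 25.
  have hV : volume (carlesonBox (Metric.closedBall x (5 * r))) =
      25 * volume (carlesonBox (Metric.closedBall x r)) := by
    rw [hI.volume_carlesonBox, hJ.volume_carlesonBox, volume_real_closedBall _ hr.le,
      volume_real_closedBall _ (by linarith), show (2 * (5 * r)) ^ 2 = 25 * (2 * r) ^ 2 by ring,
      ENNReal.ofReal_mul (by norm_num), ENNReal.ofReal_ofNat]
  rw [hV, ENNReal.mul_rpow_of_nonneg _ _ hp0] at h
  have h0 := hI.volume_carlesonBox_ne_zero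
  have ht := hI.volume_carlesonBox_ne_top
  refine (ENNReal.mul_le_mul_iff_left (ENNReal.rpow_pos h0.bot_lt ht).ne'
    (ENNReal.rpow_ne_top_of_nonneg hp0 ht)).1 (h.trans (le_of_eq ?_))
  ring

end Weights

/-! ### Reduction to a countable family of boxes. -/

section RationalBoxes

/-- The Carleson box over the closed ball with rational centre and radius. -/
def ratBox (i : ℚ × {r : ℚ // 0 < r}) : Set ℂ :=
  carlesonBox (Metric.closedBall (i.1 : ℝ) (i.2 : ℚ))

/-- The Carleson box over the fivefold enlargement of the ball underlying `ratBox i`. -/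
def ratBoxEnlarged (i : ℚ × {r : ℚ // 0 < r}) : Set ℂ :=
  carlesonBox (Metric.closedBall (i.1 : ℝ) (5 * (i.2 : ℚ)))

variable {p q : ℝ} {ω : ℂ → ℝ} {W ν : Measure ℂ}

theorem ratRadius_pos (i : ℚ × {r : ℚ // 0 < r}) : (0 : ℝ) < (i.2 : ℚ) := by
  exact_mod_cast i.2.2

theorem isBoundedInterval_ratBall (i : ℚ × {r : ℚ // 0 < r}) :
    IsBoundedInterval (Metric.closedBall (i.1 : ℝ) (i.2 : ℚ)) :=
  isBoundedInterval_closedBall _ (ratRadius_pos i)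

theorem isBoundedInterval_ratBall_enlarged (i : ℚ × {r : ℚ // 0 < r}) :
    IsBoundedInterval (Metric.closedBall (i.1 : ℝ) (5 * (i.2 : ℚ))) :=
  isBoundedInterval_closedBall _ (by have := ratRadius_pos i; positivity)

theorem measurableSet_ratBox (i : ℚ × {r : ℚ // 0 < r}) : MeasurableSet (ratBox i) :=
  (isBoundedInterval_ratBall i).measurableSet_carlesonBox

theorem ratBox_subset_enlarged (i : ℚ × {r : ℚ // 0 < r}) : ratBox i ⊆ ratBoxEnlarged i :=
  carlesonBox_mono (Metric.closedBall_subset_closedBall (by linarith [ratRadius_pos i]))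
    (isBoundedInterval_ratBall_enlarged i).volume_ne_top

theorem MemBp.isDoublingFamily (hp : 1 < p) (hω : MemBp p ω) (hne : weightMeasure ω ≠ 0) :
    IsDoublingFamily ratBox ratBoxEnlarged (weightMeasure ω) (bpChar p ω * 25 ^ p) where
  measurableSet := measurableSet_ratBox
  pos i := hω.weightMeasure_carlesonBox_ne_zero hp hne (isBoundedInterval_ratBall i)
  finite i := hω.weightMeasure_carlesonBox_ne_top hp (isBoundedInterval_ratBall i)
  const_ne_top := ENNReal.mul_ne_top hω.2.ne
    (ENNReal.rpow_ne_top_of_nonneg (by linarith) (by norm_num))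
  doubling i := hω.weightMeasure_closedBall_le hp hne _ (ratRadius_pos i)
  covering F := by
    classical
    obtain ⟨R, hR⟩ := (F.finite_toSet.image fun i => (((i.2 : ℚ)) : ℝ)).bddAbove
    -- Vitali is applied to the base intervals: boxes over disjoint intervals are disjoint, and
    -- boxes grow with their base.
    obtain ⟨u, huF, hd, hc⟩ := Vitali.exists_disjoint_subfamily_covering_enlargement_closedBall
      (F : Set (ℚ × {r : ℚ // 0 < r})) (fun i => (i.1 : ℝ)) (fun i => ((i.2 : ℚ) : ℝ)) R
      (fun i hi => hR (mem_image_of_mem _ hi)) 5 (by norm_num)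
    lift u to Finset (ℚ × {r : ℚ // 0 < r}) using F.finite_toSet.subset huF
    refine ⟨u, by exact_mod_cast huF, fun i hi j hj hij => disjoint_carlesonBox (hd hi hj hij),
      fun i hi => ?_⟩
    obtain ⟨j, hj, hij⟩ := hc i hi
    exact ⟨j, hj, carlesonBox_mono hij (isBoundedInterval_ratBall_enlarged j).volume_ne_top⟩

/-- A supremum over all Carleson boxes is a supremum over finite families of rational ones. -/
theorem iSup_carlesonBox_eq_iSup_finMax (hW : W ≪ volume)
    (hfin : ∀ J, IsBoundedInterval J → W (carlesonBox J) ≠ ∞)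
    (hpos : ∀ J, IsBoundedInterval J → W (carlesonBox J) ≠ 0) (z : ℂ) :
    ⨆ (I : Set ℝ) (_ : IsBoundedInterval I) (_ : z ∈ carlesonBox I),
      ν (carlesonBox I) / W (carlesonBox I) = ⨆ F, finMax ratBox W ν F z := by
  refine le_antisymm (iSup_le fun I => iSup₂_le fun hI hz => ?_)
    (iSup_le fun F => iSup₂_le fun i hi => ?_)
  · have key : ∀ c, W (carlesonBox I) < c →
        ν (carlesonBox I) ≤ (⨆ F, finMax ratBox W ν F z) * c := by
      intro c hc
      obtain ⟨i, hsub, hlt⟩ : ∃ i, carlesonBox I ⊆ ratBox i ∧ W (ratBox i) < c := by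
        obtain ⟨x, r, hr, h⟩ := hI.exists_rat_closedBall hW hfin hc
        exact ⟨(x, ⟨r, hr⟩), h⟩
      have h1 : ν (ratBox i) / W (ratBox i) ≤ ⨆ F, finMax ratBox W ν F z :=
        (le_finMax (Q := ratBox) (F := {i}) (i := i) (Finset.mem_singleton_self i) (hsub hz)).trans
          (le_iSup (fun F => finMax ratBox W ν F z) {i})
      have hb := isBoundedInterval_ratBall i
      replace h1 := (ENNReal.div_le_iff (hpos _ hb) (hfin _ hb)).1 h1
      exact (measure_mono hsub).trans (h1.trans (by gcongr; exact hlt.le))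
    rw [ENNReal.div_le_iff (hpos I hI) (hfin I hI)]
    set S := ⨆ F, finMax ratBox W ν F z
    -- `c` decreases to the mass of the box; multiplication by `S` is continuous when `S` is finite.
    rcases eq_or_ne S ∞ with hS | hS
    · rw [hS, ENNReal.top_mul (hpos I hI)]
      exact le_top
    · have hlim : Tendsto (fun c => S * c) (𝓝[>] (W (carlesonBox I)))
          (𝓝 (S * W (carlesonBox I))) :=
        (ENNReal.Tendsto.const_mul tendsto_id (.inr hS)).mono_left nhdsWithin_le_nhds
      have : (𝓝[>] (W (carlesonBox I))).NeBot :=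
        nhdsGT_neBot_of_exists_gt ⟨∞, (hfin I hI).lt_top⟩
      exact ge_of_tendsto hlim (eventually_nhdsWithin_of_forall key)
  · by_cases hz : z ∈ ratBox i
    · simp only [hz, indicator_of_mem]
      exact le_iSup_of_le _ (le_iSup₂_of_le (isBoundedInterval_ratBall i) hz le_rfl)
    · simp [hz]

theorem directed_finMax_rpow (r : ℝ) (hr : 0 ≤ r) :
    Directed (· ≤ ·) fun F z => finMax ratBox W ν F z ^ r := by
  classical
  exact directed_of_isDirected_le fun F G h z => ENNReal.rpow_le_rpow (finMax_mono h z) hr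

/-- Monotone convergence along the directed set of finite families, which is countable because the
boxes are rational. -/
theorem lintegral_iSup_finMax_rpow {μ : Measure ℂ} {r : ℝ} (hr : 0 < r) :
    ∫⁻ z, (⨆ F, finMax ratBox W ν F z) ^ r ∂μ = ⨆ F, ∫⁻ z, finMax ratBox W ν F z ^ r ∂μ := by
  rw [← lintegral_iSup_directed (fun F => ((measurable_finMax
    measurableSet_ratBox F).pow_const _).aemeasurable)
    (directed_finMax_rpow r hr.le)]
  exact lintegral_congr fun z => (ENNReal.orderIsoRpow r hr).map_iSup _

end RationalBoxes

/-! ### The two implications for the actual maximal functions. -/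

section Maximal

variable {p q : ℝ} {ω : ℂ → ℝ} {μ : Measure ℂ}

theorem MemBp.carlesonFunction_eq (hp : 1 < p) (hω : MemBp p ω) (hne : weightMeasure ω ≠ 0)
    (z : ℂ) : carlesonFunction ω μ z = ⨆ F, finMax ratBox (weightMeasure ω) μ F z :=
  iSup_carlesonBox_eq_iSup_finMax (weightMeasure_absolutelyContinuous ω)
    (fun _ hJ => hω.weightMeasure_carlesonBox_ne_top hp hJ)
    (fun _ hJ => hω.weightMeasure_carlesonBox_ne_zero hp hne hJ) z

theorem MemBp.maximalFunction_eq (hp : 1 < p) (hω : MemBp p ω) (hne : weightMeasure ω ≠ 0)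
    (f : ℂ → ℂ) (z : ℂ) : maximalFunction ω f z = ⨆ F, finMax ratBox (weightMeasure ω)
      ((weightMeasure ω).withDensity fun w => ‖f w‖ₑ) F z := by
  rw [← iSup_carlesonBox_eq_iSup_finMax (weightMeasure_absolutelyContinuous ω)
    (fun _ hJ => hω.weightMeasure_carlesonBox_ne_top hp hJ)
    (fun _ hJ => hω.weightMeasure_carlesonBox_ne_zero hp hne hJ) z]
  refine iSup_congr fun I => iSup_congr fun hI => ?_
  rw [withDensity_apply _ hI.measurableSet_carlesonBox]

theorem MemBp.measurable_carlesonFunction (hp : 1 < p) (hω : MemBp p ω)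
    (hne : weightMeasure ω ≠ 0) : Measurable (carlesonFunction ω μ) := by
  rw [funext (hω.carlesonFunction_eq hp hne)]
  exact Measurable.iSup fun F => measurable_finMax measurableSet_ratBox F

theorem div_le_maximalFunction (f : ℂ → ℂ) {I : Set ℝ} (hI : IsBoundedInterval I) {z : ℂ}
    (hz : z ∈ carlesonBox I) :
    (∫⁻ w in carlesonBox I, ‖f w‖ₑ ∂(weightMeasure ω)) / weightMeasure ω (carlesonBox I) ≤
      maximalFunction ω f z :=
  le_iSup_of_le I (le_iSup₂_of_le hI hz le_rfl)

theorem eLpNorm_eq_lintegral_rpow {ε α : Type*} [ENorm ε] [MeasurableSpace α] {ν : Measure α}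
    (f : α → ε) (hp : 0 < p) :
    eLpNorm f (ENNReal.ofReal p) ν = (∫⁻ z, ‖f z‖ₑ ^ p ∂ν) ^ (1 / p) := by
  rw [eLpNorm_eq_lintegral_rpow_enorm_toReal (by simpa using hp) ENNReal.ofReal_ne_top,
    ENNReal.toReal_ofReal hp.le]

theorem MemBp.lintegral_maximalFunction_rpow_le (hq : 1 < q) (hqp : q < p) (hω : MemBp p ω)
    (hne : weightMeasure ω ≠ 0)
    (hK : MemLp (carlesonFunction ω μ) (ENNReal.ofReal (p / (p - q))) (weightMeasure ω)) :
    ∃ A : ℝ≥0∞, A ≠ ∞ ∧ ∀ f : ℂ → ℂ, MemLp f (ENNReal.ofReal p) (weightMeasure ω) →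
      (∫⁻ z, maximalFunction ω f z ^ q ∂μ) ^ (1 / q) ≤
        A * eLpNorm f (ENNReal.ofReal p) (weightMeasure ω) := by
  have hp : 1 < p := hq.trans hqp
  have hp0 : 0 < p := by linarith
  have hq0 : 0 < q := by linarith
  have hpq : 0 < p - q := by linarith
  have hQ := hω.isDoublingFamily hp hne
  set C := bpChar p ω * 25 ^ p
  set W := weightMeasure ω with hW
  set N := eLpNorm (carlesonFunction ω μ) (ENNReal.ofReal (p / (p - q))) W with hN
  set B := ENNReal.ofReal (p / (p - 1)) * C with hB
  refine ⟨(C * N) ^ (1 / q) * B, ENNReal.mul_ne_top (ENNReal.rpow_ne_top_of_nonneg (by positivity)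
    (ENNReal.mul_ne_top hQ.const_ne_top hK.2.ne)) (ENNReal.mul_ne_top ENNReal.ofReal_ne_top
    hQ.const_ne_top), fun f hf => ?_⟩
  have hle : ∫⁻ z, maximalFunction ω f z ^ q ∂μ ≤
      C * N * (B ^ p * ∫⁻ z, ‖f z‖ₑ ^ p ∂W) ^ (q / p) := by
    simp only [hω.maximalFunction_eq hp hne f]
    rw [lintegral_iSup_finMax_rpow hq0]
    refine iSup_le fun F => ?_
    rw [hN, eLpNorm_eq_lintegral_rpow _ (by positivity)]
    refine hQ.lintegral_finMax_rpow_le_of_carleson hq hqp hK.1.aemeasurable (fun i z hz => ?_)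
      hf.1.enorm (fun i => ?_) F
    · have hb := isBoundedInterval_ratBall_enlarged i
      refine (ENNReal.div_le_iff (hω.weightMeasure_carlesonBox_ne_zero hp hne hb)
        (hω.weightMeasure_carlesonBox_ne_top hp hb)).1 ?_
      exact le_iSup_of_le _ (le_iSup₂_of_le hb (ratBox_subset_enlarged i hz) le_rfl)
    · rw [withDensity_apply _ (hQ.measurableSet i)]
      -- On a set of finite mass `L^p` embeds in `L^1`, so the averages of `f` are finite.
      have : IsFiniteMeasure (W.restrict (ratBox i)) :=
        ⟨by simpa using (hQ.finite i).lt_top⟩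
      exact (((hf.restrict (ratBox i)).integrable
        (by simpa using ENNReal.ofReal_le_ofReal hp.le)).hasFiniteIntegral).ne
  rw [eLpNorm_eq_lintegral_rpow f hp0]
  refine (ENNReal.rpow_le_rpow hle (by positivity)).trans (le_of_eq ?_)
  rw [ENNReal.mul_rpow_of_nonneg _ _ (by positivity : 0 ≤ 1 / q), ← ENNReal.rpow_mul,
    show q / p * (1 / q) = 1 / p by field_simp,
    ENNReal.mul_rpow_of_nonneg _ _ (by positivity : 0 ≤ 1 / p), ← ENNReal.rpow_mul,
    mul_one_div_cancel hp0.ne', ENNReal.rpow_one]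
  exact (mul_assoc _ _ _).symm

/-- Testing on the indicator of a box, whose maximal function is at least 1 on that box. -/
theorem MemBp.measure_ratBox_ne_top (hq : 1 < q) (hqp : q < p) (hω : MemBp p ω)
    (hne : weightMeasure ω ≠ 0) {A : ℝ≥0∞} (hA : A ≠ ∞)
    (h : ∀ f : ℂ → ℂ, MemLp f (ENNReal.ofReal p) (weightMeasure ω) →
      (∫⁻ z, maximalFunction ω f z ^ q ∂μ) ^ (1 / q) ≤
        A * eLpNorm f (ENNReal.ofReal p) (weightMeasure ω)) (i : ℚ × {r : ℚ // 0 < r}) :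
    μ (ratBox i) ≠ ∞ := by
  have hQ := hω.isDoublingFamily (hq.trans hqp) hne
  have hq0 : 0 < q := by linarith
  have hf : MemLp ((ratBox i).indicator fun _ => (1 : ℂ)) (ENNReal.ofReal p) (weightMeasure ω) :=
    memLp_indicator_const _ (hQ.measurableSet i) _ (.inr (hQ.finite i))
  have h1 : (∫⁻ z, maximalFunction ω ((ratBox i).indicator fun _ => (1 : ℂ)) z ^ q ∂μ) ≠ ∞ := by
    intro htop
    have h2 := h _ hf
    rw [htop, ENNReal.top_rpow_of_pos (by positivity), top_le_iff] at h2
    exact ENNReal.mul_ne_top hA hf.2.ne h2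
  refine ne_top_of_le_ne_top h1 ?_
  rw [← lintegral_indicator_one (hQ.measurableSet i)]
  refine lintegral_mono fun z => ?_
  by_cases hz : z ∈ ratBox i
  swap
  · simp [hz]
  rw [indicator_of_mem hz, Pi.one_apply]
  refine ENNReal.one_le_rpow (le_trans (le_of_eq ?_)
    (div_le_maximalFunction _ (isBoundedInterval_ratBall i) hz)) hq0
  have : ∫⁻ w in ratBox i, ‖(ratBox i).indicator (fun _ => (1 : ℂ)) w‖ₑ ∂(weightMeasure ω) =
      weightMeasure ω (ratBox i) := by
    rw [← setLIntegral_one]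
    refine setLIntegral_congr_fun (hQ.measurableSet i) fun w hw => ?_
    simp [hw]
  exact ((congrArg (· / weightMeasure ω (ratBox i)) this).trans
    (ENNReal.div_self (hQ.pos i) (hQ.finite i))).symm

theorem MemBp.memLp_carlesonFunction (hq : 1 < q) (hqp : q < p) (hω : MemBp p ω)
    (hne : weightMeasure ω ≠ 0) {A : ℝ≥0∞} (hA : A ≠ ∞)
    (h : ∀ f : ℂ → ℂ, MemLp f (ENNReal.ofReal p) (weightMeasure ω) →
      (∫⁻ z, maximalFunction ω f z ^ q ∂μ) ^ (1 / q) ≤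
        A * eLpNorm f (ENNReal.ofReal p) (weightMeasure ω)) :
    MemLp (carlesonFunction ω μ) (ENNReal.ofReal (p / (p - q))) (weightMeasure ω) := by
  have hp : 1 < p := hq.trans hqp
  have hp0 : 0 < p := by linarith
  have hq0 : 0 < q := by linarith
  have hpq : 0 < p - q := by linarith
  have hQ := hω.isDoublingFamily hp hne
  have hμ := hω.measure_ratBox_ne_top hq hqp hne hA h
  refine ⟨(hω.measurable_carlesonFunction hp hne).aestronglyMeasurable, ?_⟩
  rw [eLpNorm_eq_lintegral_rpow _ (by positivity)]
  refine ENNReal.rpow_lt_top_of_nonneg (by positivity) (ne_top_of_le_ne_top (b :=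
    (ENNReal.ofReal (p / q) * (bpChar p ω * 25 ^ p) * A ^ q) ^ (p / (p - q))) ?_ ?_)
  · exact ENNReal.rpow_ne_top_of_nonneg (by positivity) (ENNReal.mul_ne_top (ENNReal.mul_ne_top
      ENNReal.ofReal_ne_top hQ.const_ne_top) (ENNReal.rpow_ne_top_of_nonneg hq0.le hA))
  simp only [enorm_eq_self, hω.carlesonFunction_eq hp hne]
  rw [lintegral_iSup_finMax_rpow (by positivity)]
  refine iSup_le fun F => hQ.lintegral_finMax_rpow_le_of_testing hq hqp hμ F ?_
  set g := finMax ratBox (weightMeasure ω) μ F with hg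
  have hgm : Measurable g := measurable_finMax hQ.measurableSet F
  have hgt : ∀ z, g z ≠ ∞ := hQ.finMax_ne_top hμ F
  -- With this exponent `f = g ^ θ` has `f ^ p = g ^ (p / (p - q))` and `f ^ q = g ^ (q / (p - q))`,
  -- the two powers in the testing inequality.
  set θ := 1 / (p - q) with hθ
  have hθ0 : 0 < θ := by positivity
  let f : ℂ → ℂ := fun z => (((g z ^ θ).toReal : ℝ) : ℂ)
  have hfe : ∀ z, ‖f z‖ₑ = g z ^ θ := fun z => by
    have hz : g z ^ θ ≠ ∞ := ENNReal.rpow_ne_top_of_nonneg hθ0.le (hgt z)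
    simp only [f, ← ofReal_norm, Complex.norm_real, Real.norm_eq_abs,
      abs_of_nonneg ENNReal.toReal_nonneg, ENNReal.ofReal_toReal hz]
  have hnorm : eLpNorm f (ENNReal.ofReal p) (weightMeasure ω) =
      (∫⁻ z, g z ^ (p / (p - q)) ∂(weightMeasure ω)) ^ (1 / p) := by
    rw [eLpNorm_eq_lintegral_rpow f hp0]
    simp only [hfe, ← ENNReal.rpow_mul, hθ, one_div_mul_eq_div]
  have hf : MemLp f (ENNReal.ofReal p) (weightMeasure ω) := by
    refine ⟨(Complex.measurable_ofReal.comp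
      (hgm.pow_const θ).ennreal_toReal).aestronglyMeasurable, ?_⟩
    rw [hnorm]
    exact ENNReal.rpow_lt_top_of_nonneg (by positivity)
      (hQ.lintegral_finMax_rpow_ne_top hμ F (by positivity))
  -- On a box of the family, `g` is at least the ratio of that box throughout, so the average of `g
  -- ^ θ` there is at least the ratio to the power `θ`.
  have hmax : ∀ z, g z ^ θ ≤ maximalFunction ω f z := by
    intro z
    rw [← ENNReal.le_rpow_inv_iff hθ0]
    refine iSup₂_le fun i hi => ?_
    by_cases hz : z ∈ ratBox i
    · simp only [hz, indicator_of_mem]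
      rw [ENNReal.le_rpow_inv_iff hθ0]
      refine le_trans ?_ (div_le_maximalFunction f (isBoundedInterval_ratBall i) hz)
      refine (ENNReal.le_div_iff_mul_le (.inl (hQ.pos i)) (.inl (hQ.finite i))).2 ?_
      rw [← setLIntegral_const]
      refine setLIntegral_mono' (hQ.measurableSet i) fun w hw => ?_
      rw [hfe]
      gcongr
      exact le_finMax hi hw
    · simp [hz]
  have h1 := ENNReal.rpow_le_rpow (h f hf) hq0.le
  rw [← ENNReal.rpow_mul, one_div_mul_cancel hq0.ne', ENNReal.rpow_one,
    ENNReal.mul_rpow_of_nonneg _ _ hq0.le, hnorm, ← ENNReal.rpow_mul, one_div_mul_eq_div] at h1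
  refine le_trans (lintegral_mono fun z => ?_) h1
  rw [show q / (p - q) = θ * q by rw [hθ, one_div_mul_eq_div], ENNReal.rpow_mul]
  exact ENNReal.rpow_le_rpow (hmax z) hq0.le

theorem carlesonFunction_restrict_halfPlane (ω : ℂ → ℝ) (μ : Measure ℂ) :
    carlesonFunction ω (μ.restrict halfPlane) = carlesonFunction ω μ := by
  funext z
  refine iSup_congr fun I => iSup_congr fun hI => ?_
  rw [Measure.restrict_apply hI.measurableSet_carlesonBox,
    inter_eq_left.2 (carlesonBox_subset_halfPlane I)]

end Maximal

end BekolleBonami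

/-- The positive measure on the upper half-plane is the restriction of `μ` to it; only this
restriction matters. -/
theorem theorem2 (p q : ℝ) (hq : 1 < q) (hqp : q < p) (ω : ℂ → ℝ)
    (hω : BekolleBonami.MemBp p ω) (μ : MeasureTheory.Measure ℂ) :
    (∃ C : ℝ, 0 < C ∧ ∀ f : ℂ → ℂ,
      MeasureTheory.MemLp f (ENNReal.ofReal p) (BekolleBonami.weightMeasure ω) →
        (∫⁻ z in BekolleBonami.halfPlane, BekolleBonami.maximalFunction ω f z ^ q ∂μ) ^ (1 / q) ≤
          ENNReal.ofReal C *
            MeasureTheory.eLpNorm f (ENNReal.ofReal p) (BekolleBonami.weightMeasure ω)) ↔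
    MeasureTheory.MemLp (BekolleBonami.carlesonFunction ω μ) (ENNReal.ofReal (p / (p - q)))
      (BekolleBonami.weightMeasure ω) := by
  have hq0 : 0 < q := by linarith
  rcases eq_or_ne (BekolleBonami.weightMeasure ω) 0 with h0 | hne
  · refine iff_of_true ⟨1, one_pos, fun f _ => ?_⟩ (by simp [h0])
    have : ∀ z, BekolleBonami.maximalFunction ω f z = 0 := fun z => by
      simp [BekolleBonami.maximalFunction, h0]
    simp [this, hq0]
  rw [← BekolleBonami.carlesonFunction_restrict_halfPlane]
  constructor
  · rintro ⟨C, -, h⟩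
    exact hω.memLp_carlesonFunction hq hqp hne ENNReal.ofReal_ne_top h
  · intro hK
    obtain ⟨A, hA, h⟩ := hω.lintegral_maximalFunction_rpow_le hq hqp hne hK
    -- Adding 1 makes the constant strictly positive even when `A = 0`.
    refine ⟨A.toReal + 1, by positivity, fun f hf => (h f hf).trans ?_⟩
    gcongr
    rw [ENNReal.le_ofReal_iff_toReal_le hA (by positivity)]
    linarith
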